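/- **Theorem 3.2.** For a locally finite simple graph $G$ with vertex set $V$, write $v\sim x$ when $v$ and $x$ are adjacent, and for $f,g:V\to\mathbb R$ and $x\in V$ put $$\Delta(f)(x)=\sum_{v\sim x}(f(v)-f(x)),\qquad \Gamma(f,g)(x)=\tfrac12\sum_{v\sim x}(f(x)-f(v))(g(x)-g(v)),$$ $$\Gamma_2(f)(x)=\tfrac12\,\Delta(\Gamma(f,f))(x)-\Gamma(f,\Delta(f))(x).$$ The discrete Ricci curvature $\mathrm{Ric}(G)\in[-\infty,\infty]$ is the supremum of the real numbers $K$ such that $\Gamma_2(f)(x)\ge K\,\Gamma(f,f)(x)$ for all $f:V\to\mathbb R$ and all $x\in V$ (it is $-\infty$ if there is no such $K$). For a Coxeter group $W$ with its set $S$ of Coxeter generators and length function $\ell$, the Bruhat order is the partial order generated by the relations $tw<w$, where $t$ is a conjugate of an element of $S$ and $\ell(tw)<\ell(w)$. Let $H(W)$ be its Hasse diagram: the graph with vertex set $W$ in which two elements are adjacent if and only if one covers the other. Let $A_{n-1}=S_n$ be the symmetric group with generators $(i,i+1)$, $1\le i<n$. Let $B_n$ be the group of permutations $\pi$ of $\{\pm1,\dots,\pm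 n\}$ with $\pi(-a)=-\pi(a)$ for all $a$, with generators $(i,i+1)(-i,-i-1)$, $1\le i<n$, and $(1,-1)$. Let $D_n\le B_n$ be the subgroup of those $\pi$ for which an even number of positive elements have negative image, with generators $(i,i+1)(-i,-i-1)$, $1\le i<n$, and $(1,-2)(-1,2)$. Then: - $\mathrm{Ric}(H(A_{n-1}))\ge-\lfloor n^2/2\rfloor-2n+8$ for all $n\ge2$; - $\mathrm{Ric}(H(B_n))\ge4(-2n+1)$ for $2\le n\le5$; - $\mathrm{Ric}(H(B_n))\ge-2\lfloor n^2/2\rfloor-2n+6$ for all $n\ge5$; - $\mathrm{Ric}(H(D_n))\ge-2\lfloor n^2/2\rfloor-2n+6$ for all $n\ge3$. -/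

import Mathlib

namespace BruhatRicci

noncomputable section

/-! ## Discrete (Bakry–Émery) Ricci curvature of a locally finite graph -/

section Curvature

variable {V : Type*} (G : SimpleGraph V) [G.LocallyFinite]

/-- The Laplacian `Δ(f)(x) = ∑_{v ∈ B(1,x)} (f(v) - f(x))`. -/
def laplacian (f : V → ℝ) (x : V) : ℝ :=
  ∑ v ∈ G.neighborFinset x, (f v - f x)

/-- The operator `Γ(f,g)(x) = 1/2 ∑_{v ∈ B(1,x)} (f(x) - f(v)) (g(x) - g(v))`. -/
def gam (f g : V → ℝ) (x : V) : ℝ :=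
  (1 / 2) * ∑ v ∈ G.neighborFinset x, (f x - f v) * (g x - g v)

/-- The iterated operator `Γ₂(f)(x) = 1/2 Δ(Γ(f,f))(x) - Γ(f,Δ(f))(x)`. -/
def gam2 (f : V → ℝ) (x : V) : ℝ :=
  (1 / 2) * laplacian G (gam G f f) x - gam G f (laplacian G f) x

/-- The discrete Ricci curvature `Ric(G)`: the largest `K` such that
`Γ₂(f)(x) ≥ K Γ(f,f)(x)` for all real functions `f` on the vertices and all vertices `x`.
It is an extended real number, equal to `-∞` (the supremum of the empty set)
when no real `K` has this property. -/
def ric : EReal :=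
  sSup {k : EReal | ∃ K : ℝ, k = (K : EReal) ∧
    ∀ (f : V → ℝ) (x : V), K * gam G f f x ≤ gam2 G f x}

end Curvature

/-! ## Bruhat order and its Hasse diagram, for a group with distinguished generators -/

section Bruhat

variable {W : Type*} [Group W] (S : Set W)

/-- The length of `w`: the least number of factors in an expression of `w` as a
product of elements of `S`. -/
def length (w : W) : ℕ :=
  sInf {k : ℕ | ∃ l : List W, (∀ s ∈ l, s ∈ S) ∧ l.prod = w ∧ l.length = k}

/-- The set of reflections `T = ⋃_w w S w⁻¹`. -/
def reflections : Set W :=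
  {t : W | ∃ w : W, ∃ s ∈ S, t = w * s * w⁻¹}

/-- The relation `u → v`: `u = t v` for a reflection `t`, and `ℓ(u) < ℓ(v)`. -/
def Arrow (u v : W) : Prop :=
  (∃ t ∈ reflections S, u = t * v) ∧ length S u < length S v

/-- `u ≤ v` in the Bruhat order: there is a finite (possibly empty) chain of arrows
from `u` to `v`. -/
def BruhatLE (u v : W) : Prop :=
  Relation.ReflTransGen (Arrow S) u v

theorem BruhatLE.eq_or_length_lt {u v : W} (h : BruhatLE S u v) :
    u = v ∨ length S u < length S v := by
  induction h with
  | refl => exact Or.inl rfl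
  | tail _ h2 ih =>
    rcases ih with rfl | ih
    · exact Or.inr h2.2
    · exact Or.inr (ih.trans h2.2)

/-- The (strong) Bruhat order as a partial order. -/
@[reducible] def bruhatOrder : PartialOrder W where
  le := BruhatLE S
  le_refl _ := Relation.ReflTransGen.refl
  le_trans _ _ _ := Relation.ReflTransGen.trans
  le_antisymm u v h1 h2 := by
    rcases BruhatLE.eq_or_length_lt S h1 with h | h
    · exact h
    · rcases BruhatLE.eq_or_length_lt S h2 with h' | h'
      · exact h'.symm
      · omega

/-- The graph `H(W)`: the vertices are the elements of `W`, and two elements are adjacent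
if and only if one covers the other in the Bruhat order. -/
def H : SimpleGraph W :=
  @SimpleGraph.hasse W (bruhatOrder S).toPreorder

instance [Finite W] : (H S).LocallyFinite :=
  fun _ => Fintype.ofFinite _

end Bruhat

/-! ## The Coxeter groups of types A, B and D -/

/-- The Coxeter generators of the symmetric group on `n` letters (type `A_{n-1}`):
the adjacent transpositions `(i, i+1)`. -/
def gensA (n : ℕ) : Set (Equiv.Perm (Fin n)) :=
  {w | ∃ i j : Fin n, i.val + 1 = j.val ∧ w = Equiv.swap i j}

/-- The set `{±1, …, ±n}`. -/
abbrev SignedSet (n : ℕ) : Type :=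
  {a : ℤ // a ∈ (Finset.Icc (-(n : ℤ)) n).erase 0}

instance (n : ℕ) : Neg (SignedSet n) where
  neg a := ⟨-a.1, by have := a.2; simp only [Finset.mem_erase, Finset.mem_Icc] at *; omega⟩

@[simp] theorem SignedSet.coe_neg {n : ℕ} (a : SignedSet n) : (-a).1 = -a.1 := rfl

theorem SignedSet.neg_neg {n : ℕ} (a : SignedSet n) : - -a = a :=
  Subtype.ext (by simp)

theorem SignedSet.ne_zero {n : ℕ} (a : SignedSet n) : a.1 ≠ 0 :=
  (Finset.mem_erase.mp a.2).1

/-- The hyperoctahedral group `B_n`: the permutations `π` of `{±1, …, ±n}` with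
`π(-a) = -π(a)` for all `a`. -/
def groupB (n : ℕ) : Subgroup (Equiv.Perm (SignedSet n)) where
  carrier := {π | ∀ a, π (-a) = -π a}
  one_mem' _ := rfl
  mul_mem' {π σ} hπ hσ a := by simp only [Equiv.Perm.mul_apply]; rw [hσ a, hπ]
  inv_mem' {π} hπ a := by
    rw [Equiv.Perm.inv_eq_iff_eq, hπ]
    simp

/-- The number of positive elements with negative image. -/
def negCount {n : ℕ} (π : Equiv.Perm (SignedSet n)) : ℕ :=
  (Finset.univ.filter fun a : SignedSet n => 0 < a.1 ∧ (π a).1 < 0).card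

theorem neg_one_pow_negCount {n : ℕ} (π : Equiv.Perm (SignedSet n)) :
    (-1 : ℤ) ^ negCount π =
      ∏ a ∈ Finset.univ.filter (fun a : SignedSet n => 0 < a.1), Int.sign (π a).1 := by
  rw [negCount, ← Finset.filter_filter, ← Finset.prod_const, Finset.prod_filter]
  refine Finset.prod_congr rfl fun a _ => ?_
  split_ifs with h
  · exact (Int.sign_eq_neg_one_of_neg h).symm
  · have := (π a).ne_zero
    exact (Int.sign_eq_one_of_pos (by omega)).symm

/-- The absolute value on `{±1, …, ±n}`. -/
def SignedSet.abs {n : ℕ} (a : SignedSet n) : SignedSet n := if 0 < a.1 then a else -a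

theorem SignedSet.abs_pos {n : ℕ} (a : SignedSet n) : 0 < a.abs.1 := by
  have := a.ne_zero
  unfold SignedSet.abs
  split_ifs with h
  · exact h
  · rw [SignedSet.coe_neg]; omega

theorem SignedSet.abs_of_pos {n : ℕ} {a : SignedSet n} (h : 0 < a.1) : a.abs = a :=
  if_pos h

theorem SignedSet.abs_neg {n : ℕ} (a : SignedSet n) : (-a).abs = a.abs := by
  have := a.ne_zero
  unfold SignedSet.abs
  rw [SignedSet.coe_neg]
  split_ifs with h h'
  · omega
  · rfl
  · exact SignedSet.neg_neg a
  · omega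

theorem abs_apply_abs {n : ℕ} {π : Equiv.Perm (SignedSet n)} (hπ : π ∈ groupB n)
    (a : SignedSet n) : (π a.abs).abs = (π a).abs := by
  by_cases h : 0 < a.1
  · rw [SignedSet.abs_of_pos h]
  · rw [show a.abs = -a from if_neg h, hπ a, SignedSet.abs_neg]

theorem sign_apply {n : ℕ} {π : Equiv.Perm (SignedSet n)} (hπ : π ∈ groupB n)
    (a : SignedSet n) : Int.sign (π a).1 = Int.sign (π a.abs).1 * Int.sign a.1 := by
  by_cases h : 0 < a.1
  · rw [SignedSet.abs_of_pos h, Int.sign_eq_one_of_pos h, mul_one]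
  · have := a.ne_zero
    rw [show a.abs = -a from if_neg h, hπ a, SignedSet.coe_neg, Int.sign_neg,
      Int.sign_eq_neg_one_of_neg (show a.1 < 0 by omega)]
    ring

theorem even_negCount_mul {n : ℕ} {π σ : Equiv.Perm (SignedSet n)}
    (hπ : π ∈ groupB n) (hσ : σ ∈ groupB n) :
    Even (negCount (π * σ)) ↔ (Even (negCount π) ↔ Even (negCount σ)) := by
  have key : (-1 : ℤ) ^ negCount (π * σ) = (-1) ^ (negCount π + negCount σ) := by
    rw [pow_add, neg_one_pow_negCount, neg_one_pow_negCount, neg_one_pow_negCount]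
    have h1 : ∏ a ∈ Finset.univ.filter (fun a : SignedSet n => 0 < a.1), Int.sign (π a).1 =
        ∏ a ∈ Finset.univ.filter (fun a : SignedSet n => 0 < a.1),
          Int.sign (π (σ a).abs).1 := by
      refine Finset.prod_nbij' (fun a => (σ⁻¹ a).abs) (fun a => (σ a).abs) ?_ ?_ ?_ ?_ ?_
      · intro a _; simpa using SignedSet.abs_pos _
      · intro a _; simpa using SignedSet.abs_pos _
      · intro a ha
        rw [abs_apply_abs hσ, show ∀ b, σ (σ⁻¹ b) = b from σ.apply_symm_apply,
          SignedSet.abs_of_pos (Finset.mem_filter.mp ha).2]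
      · intro a ha
        rw [abs_apply_abs (inv_mem hσ), show ∀ b, σ⁻¹ (σ b) = b from σ.symm_apply_apply,
          SignedSet.abs_of_pos (Finset.mem_filter.mp ha).2]
      · intro a ha
        rw [abs_apply_abs hσ, show ∀ b, σ (σ⁻¹ b) = b from σ.apply_symm_apply,
          SignedSet.abs_of_pos (Finset.mem_filter.mp ha).2]
    rw [h1, ← Finset.prod_mul_distrib]
    exact Finset.prod_congr rfl fun a _ => sign_apply hπ (σ a)
  rw [← Nat.even_add]
  rcases Nat.even_or_odd (negCount (π * σ)) with h | h <;>
    rcases Nat.even_or_odd (negCount π + negCount σ) with h' | h' <;>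
    simp only [h.neg_one_pow, h'.neg_one_pow] at key
  · exact iff_of_true h h'
  · norm_num at key
  · norm_num at key
  · exact iff_of_false (Nat.not_even_iff_odd.mpr h) (Nat.not_even_iff_odd.mpr h')

/-- The even hyperoctahedral group `D_n`: the elements of `B_n` for which an even number of
positive elements have negative image. -/
def groupD (n : ℕ) : Subgroup (Equiv.Perm (SignedSet n)) where
  carrier := {π | π ∈ groupB n ∧ Even (negCount π)}
  one_mem' := by
    refine ⟨one_mem _, ?_⟩
    have : negCount (1 : Equiv.Perm (SignedSet n)) = 0 := by
      rw [negCount, Finset.card_eq_zero, Finset.filter_eq_empty_iff]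
      rintro a - ⟨h1, h2⟩
      exact absurd h1 (not_lt.mpr h2.le)
    simp [this]
  mul_mem' {π σ} hπ hσ :=
    ⟨mul_mem hπ.1 hσ.1, (even_negCount_mul hπ.1 hσ.1).mpr ⟨fun _ => hσ.2, fun _ => hπ.2⟩⟩
  inv_mem' {π} hπ := by
    refine ⟨inv_mem hπ.1, ?_⟩
    have h := even_negCount_mul hπ.1 (inv_mem hπ.1)
    have h1 : negCount (π * π⁻¹) = 0 := by
      rw [mul_inv_cancel, negCount, Finset.card_eq_zero, Finset.filter_eq_empty_iff]
      rintro a - ⟨h1, h2⟩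
      exact absurd h1 (not_lt.mpr h2.le)
    rw [h1] at h
    exact (h.mp (by simp)).mp hπ.2

/-- The signed permutation `(a, b)(-a, -b)`. -/
def signedSwap {n : ℕ} (a b : SignedSet n) : Equiv.Perm (SignedSet n) :=
  Equiv.swap a b * Equiv.swap (-a) (-b)

/-- The Coxeter generators of `B_n`: the elements `(i, i+1)(-i, -(i+1))` for `1 ≤ i < n`,
and `(1, -1)`. -/
def gensB (n : ℕ) : Set (groupB n) :=
  {w | (∃ a b : SignedSet n, 0 < a.1 ∧ b.1 = a.1 + 1 ∧ w.1 = signedSwap a b) ∨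
    (∃ a : SignedSet n, a.1 = 1 ∧ w.1 = Equiv.swap a (-a))}

/-- The Coxeter generators of `D_n`: the elements `(i, i+1)(-i, -(i+1))` for `1 ≤ i < n`,
and `(1, -2)(-1, 2)`. -/
def gensD (n : ℕ) : Set (groupD n) :=
  {w | (∃ a b : SignedSet n, 0 < a.1 ∧ b.1 = a.1 + 1 ∧ w.1 = signedSwap a b) ∨
    (∃ a b : SignedSet n, a.1 = 1 ∧ b.1 = 2 ∧ w.1 = signedSwap a (-b))}

end

end BruhatRicci

open BruhatRicci

namespace BruhatRicci

/-! ## A lower bound for the curvature in terms of the maximal degree -/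

section CurvatureBound

variable {V : Type*} (G : SimpleGraph V) [G.LocallyFinite]

/-! Only the maximal degree `D` of the graph matters: every graph with degrees at most `D` has
curvature at least `2 - D`. Expanding `Γ₂(f)(x)` over the neighbours `v` of `x` and completing the
square in each term, every square may be dropped except that of the edge leading back to `x`; this
is `gam2_lower_bound`.

In a Bruhat graph, a covering relation is left multiplication by a reflection, so degrees are at
most the number of reflections (`degree_H_le`). Types B and D share the bound `n ^ 2`, type A has
`n.choose 2`. The stated bounds lie below `2 - D`, except for `S_2`, where the term `(Δf)²/2` makes
up the difference. -/

theorem gam_self (f : V → ℝ) (x : V) :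
    gam G f f x = (1 / 2) * ∑ v ∈ G.neighborFinset x, (f v - f x) ^ 2 := by
  rw [gam]
  congr 1
  exact Finset.sum_congr rfl fun v _ => by ring

theorem gam_self_nonneg (f : V → ℝ) (x : V) : 0 ≤ gam G f f x := by
  rw [gam_self]
  positivity

/-- The contribution of a neighbour `v` of `x` to `Γ₂(f)(x)`, bounded below by keeping only
the edge from `v` back to `x`. -/
theorem neighbor_term_lower_bound (f : V → ℝ) {x v : V} (h : G.Adj x v) :
    (1 / 4) * (4 - (G.degree v : ℝ)) * (f v - f x) ^ 2 ≤
      (1 / 2) * gam G f f v - (1 / 2) * (f v - f x) * laplacian G f v := by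
  have hsum : (1 / 2) * gam G f f v - (1 / 2) * (f v - f x) * laplacian G f v =
      (1 / 4) * (∑ u ∈ G.neighborFinset v, (f u - f v - (f v - f x)) ^ 2 -
        (G.degree v : ℝ) * (f v - f x) ^ 2) := by
    rw [gam_self, laplacian, ← SimpleGraph.card_neighborFinset_eq_degree, ← nsmul_eq_mul,
      ← Finset.sum_const, ← Finset.sum_sub_distrib]
    simp only [Finset.mul_sum]
    rw [← Finset.sum_sub_distrib]
    exact Finset.sum_congr rfl fun u _ => by ring
  -- The summand at `u = x` is `(2 * (f v - f x)) ^ 2`, which is the source of the 4 in `4 -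
  -- G.degree v`.
  have hx : (f x - f v - (f v - f x)) ^ 2 ≤
      ∑ u ∈ G.neighborFinset v, (f u - f v - (f v - f x)) ^ 2 :=
    Finset.single_le_sum (f := fun u => (f u - f v - (f v - f x)) ^ 2)
      (fun u _ => sq_nonneg _) ((G.mem_neighborFinset v x).mpr h.symm)
  rw [hsum]
  nlinarith [hx]

/-- The neighbour terms contribute `(2 - D / 2) * gam G f f x`, since `∑ (f v - f x) ^ 2` is twice
`gam G f f x`; the term `-(1 / 2) * G.degree x * gam G f f x` costs another `D / 2`. -/
theorem gam2_lower_bound {D : ℕ} (hD : ∀ x, G.degree x ≤ D) (f : V → ℝ) (x : V) :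
    (2 - (D : ℝ)) * gam G f f x + (1 / 2) * laplacian G f x ^ 2 ≤ gam2 G f x := by
  have hgam2 : gam2 G f x =
      ∑ v ∈ G.neighborFinset x,
        ((1 / 2) * gam G f f v - (1 / 2) * (f v - f x) * laplacian G f v) -
      (1 / 2) * (G.degree x : ℝ) * gam G f f x + (1 / 2) * laplacian G f x ^ 2 := by
    have h1 : (G.degree x : ℝ) * gam G f f x = ∑ v ∈ G.neighborFinset x, gam G f f x := by
      rw [Finset.sum_const, SimpleGraph.card_neighborFinset_eq_degree, nsmul_eq_mul]
    have h2 : laplacian G f x ^ 2 =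
        ∑ v ∈ G.neighborFinset x, (f v - f x) * laplacian G f x := by
      rw [← Finset.sum_mul, sq]
      rfl
    rw [mul_assoc, h1, h2, gam2, gam]
    conv_lhs => rw [laplacian]
    simp only [Finset.mul_sum]
    rw [← Finset.sum_sub_distrib, ← Finset.sum_sub_distrib, ← Finset.sum_add_distrib]
    exact Finset.sum_congr rfl fun v _ => by ring
  have hterms : (1 / 4) * (4 - (D : ℝ)) * ∑ v ∈ G.neighborFinset x, (f v - f x) ^ 2 ≤
      ∑ v ∈ G.neighborFinset x,
        ((1 / 2) * gam G f f v - (1 / 2) * (f v - f x) * laplacian G f v) := by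
    rw [Finset.mul_sum]
    refine Finset.sum_le_sum fun v hv => ?_
    refine le_trans ?_ (neighbor_term_lower_bound G f ((G.mem_neighborFinset x v).mp hv))
    have : (G.degree v : ℝ) ≤ D := by exact_mod_cast hD v
    gcongr
  have hdeg : (G.degree x : ℝ) * gam G f f x ≤ D * gam G f f x :=
    mul_le_mul_of_nonneg_right (by exact_mod_cast hD x) (gam_self_nonneg G f x)
  have hself := gam_self G f x
  rw [hgam2]
  nlinarith

theorem le_ric_of_forall {K : ℝ} (h : ∀ (f : V → ℝ) (x : V), K * gam G f f x ≤ gam2 G f x) :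
    (K : EReal) ≤ ric G :=
  le_sSup ⟨K, rfl, h⟩

theorem le_ric_of_degree_le {D : ℕ} (hD : ∀ x, G.degree x ≤ D) {K : ℝ} (hK : K ≤ 2 - D) :
    (K : EReal) ≤ ric G := by
  refine le_ric_of_forall G fun f x => ?_
  have h1 := gam2_lower_bound G hD f x
  have h2 := mul_le_mul_of_nonneg_right hK (gam_self_nonneg G f x)
  nlinarith [sq_nonneg (laplacian G f x)]

/-- With at most one neighbour, half the squared Laplacian equals `gam G f f x`, so keeping it
improves `2 - D = 1` to 2. -/
theorem two_le_ric_of_degree_le_one (hD : ∀ x, G.degree x ≤ 1) : ((2 : ℝ) : EReal) ≤ ric G := by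
  refine le_ric_of_forall G fun f x => ?_
  have h1 := gam2_lower_bound G hD f x
  have h2 : (1 / 2) * laplacian G f x ^ 2 = gam G f f x := by
    have : Nonempty V := ⟨x⟩
    have hcard : (G.neighborFinset x).card ≤ 1 := hD x
    rw [gam_self, laplacian]
    rcases Finset.card_le_one_iff_subset_singleton.mp hcard with ⟨v, hv⟩
    rcases Finset.subset_singleton_iff.mp hv with h | h <;> simp [h]
  rw [h2] at h1
  push_cast at h1
  linarith

end CurvatureBound

/-! ## Degrees in the Hasse diagram are bounded by the number of reflections -/

section BruhatDegree

variable {W : Type*} [Group W] (S : Set W)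

theorem reflections_mul_self (hS : ∀ s ∈ S, s * s = 1) {t : W} (ht : t ∈ reflections S) :
    t * t = 1 := by
  obtain ⟨w, s, hs, rfl⟩ := ht
  calc w * s * w⁻¹ * (w * s * w⁻¹) = w * (s * s) * w⁻¹ := by group
    _ = 1 := by rw [hS s hs]; group

/-- The first arrow of a chain from `u` to `v` already strictly increases, so a cover leaves room
for nothing after it. -/
theorem exists_reflection_of_covBy {u v : W}
    (h : @CovBy W (bruhatOrder S).toLT u v) : ∃ t ∈ reflections S, u = t * v := by
  let _ := bruhatOrder S
  have hle : BruhatLE S u v := h.1.le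
  rcases Relation.ReflTransGen.cases_head hle with rfl | ⟨z, huz, hzv⟩
  · exact absurd h.1 (lt_irrefl _)
  · have hlt : u < z := by
      refine lt_of_le_of_ne (show BruhatLE S u z from Relation.ReflTransGen.single huz) ?_
      rintro rfl
      exact lt_irrefl _ huz.2
    have hzv' : z ≤ v := hzv
    rcases hzv'.eq_or_lt with rfl | hzv'
    · exact huz.1
    · exact absurd hzv' (h.2 hlt)

theorem exists_reflection_of_adj (hS : ∀ s ∈ S, s * s = 1) {x v : W} (h : (H S).Adj x v) :
    ∃ t ∈ reflections S, v = t * x := by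
  rcases h with h | h
  · obtain ⟨t, ht, rfl⟩ := exists_reflection_of_covBy S h
    exact ⟨t, ht, by rw [← mul_assoc, reflections_mul_self S hS ht, one_mul]⟩
  · exact exists_reflection_of_covBy S h

theorem degree_H_le [(H S).LocallyFinite] {P : Type*} [Group P] (φ : W →* P)
    (hφ : Function.Injective φ) (hS : ∀ s ∈ S, s * s = 1) (T : Finset P)
    (hT : ∀ t ∈ reflections S, φ t ∈ T) (x : W) : (H S).degree x ≤ T.card := by
  rw [← SimpleGraph.card_neighborFinset_eq_degree]
  -- A neighbour `v = t * x` is determined by its reflection `t = v * x⁻¹`. The reflections are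
  -- counted after embedding by `φ`, so that subgroups can use the ambient permutation group.
  refine Finset.card_le_card_of_injOn (fun v => φ (v * x⁻¹)) ?_ ?_
  · intro v hv
    obtain ⟨t, ht, rfl⟩ := exists_reflection_of_adj S hS (((H S).mem_neighborFinset x v).mp hv)
    simpa using hT t ht
  · intro v _ w _ hvw
    exact mul_right_cancel (hφ hvw)

end BruhatDegree

/-! ## Reflections in types A, B and D -/

section Reflections

theorem degree_gensA_le (n : ℕ) [(H (gensA n)).LocallyFinite] (x : Equiv.Perm (Fin n)) :
    (H (gensA n)).degree x ≤ n.choose 2 := by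
  classical
  let F : {z : Sym2 (Fin n) // ¬ z.IsDiag} → Equiv.Perm (Fin n) := fun z =>
    Sym2.lift ⟨fun i j => Equiv.swap i j, fun i j => Equiv.swap_comm i j⟩ z.1
  have hcard : (Finset.univ.image F).card ≤ n.choose 2 := by
    refine Finset.card_image_le.trans ?_
    rw [Finset.card_univ, Sym2.card_subtype_not_diag, Fintype.card_fin]
  refine (degree_H_le (gensA n) (MonoidHom.id _) Function.injective_id ?_ _ ?_ x).trans hcard
  · rintro _ ⟨i, j, -, rfl⟩
    exact Equiv.swap_mul_self i j
  · rintro _ ⟨w, _, ⟨i, j, hij, rfl⟩, rfl⟩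
    have hne : i ≠ j := by rintro rfl; omega
    refine Finset.mem_image.mpr ⟨⟨s(w i, w j), by simpa using hne⟩, Finset.mem_univ _, ?_⟩
    exact Equiv.swap_apply_apply w i j

variable {n : ℕ}

theorem SignedSet.ne_neg_self (a : SignedSet n) : a ≠ -a := by
  intro h
  have h1 := congrArg Subtype.val h
  have := a.ne_zero
  rw [SignedSet.coe_neg] at h1
  omega

theorem signedSwap_swap (a b : SignedSet n) : signedSwap a b = signedSwap b a := by
  rw [signedSwap, signedSwap, Equiv.swap_comm a, Equiv.swap_comm (-a)]

theorem signedSwap_neg_neg {a b : SignedSet n} (hb : b ≠ -a) :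
    signedSwap (-a) (-b) = signedSwap a b := by
  have ha : a ≠ -b := by
    rintro rfl
    exact hb (SignedSet.neg_neg b).symm
  rw [signedSwap, signedSwap, SignedSet.neg_neg, SignedSet.neg_neg]
  by_cases hab : a = b
  · subst hab
    simp
  · refine (Equiv.Perm.Disjoint.commute ?_).eq
    intro c
    by_cases h1 : c = a
    · subst h1
      exact Or.inl (Equiv.swap_apply_of_ne_of_ne (SignedSet.ne_neg_self c) ha)
    · by_cases h2 : c = b
      · subst h2
        exact Or.inl (Equiv.swap_apply_of_ne_of_ne hb (SignedSet.ne_neg_self c))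
      · exact Or.inr (Equiv.swap_apply_of_ne_of_ne h1 h2)

theorem signedSwap_mul_self {a b : SignedSet n} (hb : b ≠ -a) :
    signedSwap a b * signedSwap a b = 1 := by
  -- Negating both arguments reverses the order of the two transpositions, so the product
  -- telescopes.
  nth_rewrite 2 [← signedSwap_neg_neg hb]
  rw [signedSwap, signedSwap, SignedSet.neg_neg, SignedSet.neg_neg, mul_assoc,
    ← mul_assoc (Equiv.swap (-a) (-b)), Equiv.swap_mul_self, one_mul, Equiv.swap_mul_self]

theorem conj_signedSwap {w : Equiv.Perm (SignedSet n)} (hw : w ∈ groupB n) (a b : SignedSet n) :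
    w * signedSwap a b * w⁻¹ = signedSwap (w a) (w b) := by
  rw [signedSwap, signedSwap, ← hw a, ← hw b, Equiv.swap_apply_apply, Equiv.swap_apply_apply]
  group

/-- The `n²` reflections of `B_n`, indexed by ordered pairs from `{1, …, n}`: the transposition
of `a` and `-a` for `(a, a)`, and for `a < b` the two signed swaps given by `(a, b)` and
`(b, a)`. -/
def reflectionB (n : ℕ) (p : Fin n × Fin n) : Equiv.Perm (SignedSet n) :=
  let e : Fin n → SignedSet n := fun i =>
    ⟨(i : ℤ) + 1, by simp only [Finset.mem_erase, Finset.mem_Icc]; omega⟩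
  if p.1 = p.2 then Equiv.swap (e p.1) (-e p.1)
  else if p.1 < p.2 then signedSwap (e p.1) (e p.2)
  else signedSwap (e p.1) (-e p.2)

theorem SignedSet.exists_fin {a : SignedSet n} (ha : 0 < a.1) : ∃ i : Fin n, a.1 = i + 1 := by
  have := a.2
  simp only [Finset.mem_erase, Finset.mem_Icc] at this
  exact ⟨⟨(a.1 - 1).toNat, by omega⟩, by simp; omega⟩

theorem swap_neg_mem_range (a : SignedSet n) :
    Equiv.swap a (-a) ∈ Set.range (reflectionB n) := by
  wlog ha : 0 < a.1 generalizing a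
  · have := this (-a) (by have := a.ne_zero; rw [SignedSet.coe_neg]; omega)
    rwa [SignedSet.neg_neg, Equiv.swap_comm] at this
  obtain ⟨i, hi⟩ := SignedSet.exists_fin ha
  refine ⟨(i, i), ?_⟩
  simp only [reflectionB, if_true]
  rw [show a = ⟨(i : ℤ) + 1, hi ▸ a.2⟩ from Subtype.ext hi]

/-- Exchanging the arguments or negating both leaves the signed swap unchanged. One may thus take
`a` positive, and the sign of `b` then decides whether the smaller or the larger index comes first.
-/
theorem signedSwap_mem_range {a b : SignedSet n} (hab : a ≠ b) (hb : b ≠ -a) :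
    signedSwap a b ∈ Set.range (reflectionB n) := by
  wlog ha : 0 < a.1 generalizing a b
  · rw [← signedSwap_neg_neg hb]
    refine this (fun h => hab ?_) (fun h => hb ?_) ?_
    · rw [← SignedSet.neg_neg a, h, SignedSet.neg_neg]
    · rw [← SignedSet.neg_neg b, h, SignedSet.neg_neg]
    · have := a.ne_zero
      rw [SignedSet.coe_neg]
      omega
  obtain ⟨i, hi⟩ := SignedSet.exists_fin ha
  have hae : a = ⟨(i : ℤ) + 1, hi ▸ a.2⟩ := Subtype.ext hi
  by_cases hpos : 0 < b.1
  · obtain ⟨j, hj⟩ := SignedSet.exists_fin hpos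
    have hbe : b = ⟨(j : ℤ) + 1, hj ▸ b.2⟩ := Subtype.ext hj
    have hij : i ≠ j := by
      rintro rfl
      exact hab (Subtype.ext (hi.trans hj.symm))
    rcases lt_or_gt_of_ne hij with h | h
    · refine ⟨(i, j), ?_⟩
      simp only [reflectionB, if_neg hij, if_pos h]
      rw [hae, hbe]
    · refine ⟨(j, i), ?_⟩
      simp only [reflectionB, if_neg hij.symm, if_pos h]
      rw [hae, hbe, signedSwap_swap]
  · have hc : 0 < (-b).1 := by
      have := b.ne_zero
      rw [SignedSet.coe_neg]
      omega
    obtain ⟨j, hj⟩ := SignedSet.exists_fin hc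
    have hce : -b = ⟨(j : ℤ) + 1, hj ▸ (-b).2⟩ := Subtype.ext hj
    have hij : i ≠ j := by
      rintro rfl
      apply hb
      rw [← SignedSet.neg_neg b, show -b = a from Subtype.ext (hj.trans hi.symm)]
    rcases lt_or_gt_of_ne hij with h | h
    · refine ⟨(j, i), ?_⟩
      simp only [reflectionB, if_neg hij.symm, if_neg h.not_gt]
      rw [← hae, ← hce, signedSwap_swap, signedSwap_neg_neg hb]
    · refine ⟨(i, j), ?_⟩
      simp only [reflectionB, if_neg hij, if_neg h.not_gt]
      rw [← hae, ← hce, SignedSet.neg_neg]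

theorem conj_signedSwap_mem_range {w : Equiv.Perm (SignedSet n)} (hw : w ∈ groupB n)
    {a b : SignedSet n} (hab : a ≠ b) (hb : b ≠ -a) :
    w * signedSwap a b * w⁻¹ ∈ Set.range (reflectionB n) := by
  rw [conj_signedSwap hw]
  refine signedSwap_mem_range (w.injective.ne hab) ?_
  rw [← hw a]
  exact w.injective.ne hb

theorem conj_swap_neg_mem_range {w : Equiv.Perm (SignedSet n)} (hw : w ∈ groupB n)
    (a : SignedSet n) : w * Equiv.swap a (-a) * w⁻¹ ∈ Set.range (reflectionB n) := by
  rw [← Equiv.swap_apply_apply, hw]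
  exact swap_neg_mem_range _

theorem SignedSet.ne_of_coe_ne {a b : SignedSet n} (h : a.1 ≠ b.1) : a ≠ b :=
  fun hab => h (congrArg Subtype.val hab)

theorem card_image_reflectionB_le [DecidableEq (Equiv.Perm (SignedSet n))] :
    (Finset.univ.image (reflectionB n)).card ≤ n ^ 2 :=
  Finset.card_image_le.trans (by simp [sq])

theorem degree_gensB_le [(H (gensB n)).LocallyFinite] (x : groupB n) :
    (H (gensB n)).degree x ≤ n ^ 2 := by
  classical
  refine (degree_H_le (gensB n) (groupB n).subtype (groupB n).subtype_injective ?_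
    (Finset.univ.image (reflectionB n)) ?_ x).trans card_image_reflectionB_le
  · rintro s (⟨a, b, ha, hb, hs⟩ | ⟨a, -, hs⟩) <;> apply Subtype.ext <;>
      rw [Subgroup.coe_mul, hs]
    · exact signedSwap_mul_self (SignedSet.ne_of_coe_ne (by rw [SignedSet.coe_neg]; omega))
    · exact Equiv.swap_mul_self _ _
  · rintro _ ⟨w, s, hs, rfl⟩
    simp only [Finset.mem_image, Finset.mem_univ, true_and, Subgroup.coe_subtype,
      Subgroup.coe_mul, Subgroup.coe_inv]
    rcases hs with ⟨a, b, ha, hb, hs⟩ | ⟨a, -, hs⟩ <;> rw [hs]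
    · exact conj_signedSwap_mem_range w.2 (SignedSet.ne_of_coe_ne (by omega))
        (SignedSet.ne_of_coe_ne (by rw [SignedSet.coe_neg]; omega))
    · exact conj_swap_neg_mem_range w.2 a

theorem exists_signedSwap_of_mem_gensD {s : groupD n} (hs : s ∈ gensD n) :
    ∃ a b : SignedSet n, a ≠ b ∧ b ≠ -a ∧ s.1 = signedSwap a b := by
  rcases hs with ⟨a, b, ha, hb, hs⟩ | ⟨a, b, ha, hb, hs⟩
  · exact ⟨a, b, SignedSet.ne_of_coe_ne (by omega),
      SignedSet.ne_of_coe_ne (by rw [SignedSet.coe_neg]; omega), hs⟩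
  · exact ⟨a, -b, SignedSet.ne_of_coe_ne (by rw [SignedSet.coe_neg]; omega),
      SignedSet.ne_of_coe_ne (by rw [SignedSet.coe_neg, SignedSet.coe_neg]; omega), hs⟩

/-- The generators are signed swaps, so their conjugates lie among the reflections of `B_n`, and the
count for type B is enough. -/
theorem degree_gensD_le [(H (gensD n)).LocallyFinite] (x : groupD n) :
    (H (gensD n)).degree x ≤ n ^ 2 := by
  classical
  refine (degree_H_le (gensD n) (groupD n).subtype (groupD n).subtype_injective ?_
    (Finset.univ.image (reflectionB n)) ?_ x).trans card_image_reflectionB_le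
  · intro s hs
    obtain ⟨a, b, -, hb, hs⟩ := exists_signedSwap_of_mem_gensD hs
    apply Subtype.ext
    rw [Subgroup.coe_mul, hs]
    exact signedSwap_mul_self hb
  · rintro _ ⟨w, s, hs, rfl⟩
    obtain ⟨a, b, hab, hb, hs⟩ := exists_signedSwap_of_mem_gensD hs
    simp only [Finset.mem_image, Finset.mem_univ, true_and, Subgroup.coe_subtype,
      Subgroup.coe_mul, Subgroup.coe_inv]
    rw [hs]
    exact conj_signedSwap_mem_range w.2.1 hab hb

end Reflections

/-! ## Comparison with the explicit bounds -/

theorem natCast_sq_half_le_floor (n : ℕ) : (n : ℤ) ^ 2 ≤ 2 * ⌊(n : ℝ) ^ 2 / 2⌋ + 1 := by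
  have h := Int.lt_floor_add_one ((n : ℝ) ^ 2 / 2)
  have h2 : ((n : ℤ) ^ 2 : ℤ) < 2 * ⌊(n : ℝ) ^ 2 / 2⌋ + 2 := by
    have : (n : ℝ) ^ 2 < 2 * (⌊(n : ℝ) ^ 2 / 2⌋ : ℝ) + 2 := by linarith
    exact_mod_cast this
  omega

theorem two_mul_choose_two (n : ℕ) : 2 * (n.choose 2 : ℤ) = (n : ℤ) ^ 2 - n := by
  have h := Nat.cast_choose_two ℚ n
  have : 2 * (n.choose 2 : ℚ) = (n : ℚ) ^ 2 - n := by rw [h]; ring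
  exact_mod_cast this

theorem bound_le_of_sq_degree {n : ℕ} (hn : 3 ≤ n) :
    ((-2 * ⌊(n : ℝ) ^ 2 / 2⌋ - 2 * (n : ℤ) + 6 : ℤ) : ℝ) ≤ 2 - ((n ^ 2 : ℕ) : ℝ) := by
  have h := natCast_sq_half_le_floor n
  -- Since `2 * ⌊n ^ 2 / 2⌋ ≥ n ^ 2 - 1`, the squares cancel and `5 ≤ 2 * n` remains.
  have h2 : (-2 * ⌊(n : ℝ) ^ 2 / 2⌋ - 2 * (n : ℤ) + 6 : ℤ) ≤ 2 - ((n ^ 2 : ℕ) : ℤ) := by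
    push_cast
    omega
  exact_mod_cast h2

end BruhatRicci

theorem theorem3p2 :
    (∀ n : ℕ, 2 ≤ n →
      (((-⌊(n : ℝ) ^ 2 / 2⌋ - 2 * (n : ℤ) + 8 : ℤ) : ℝ) : EReal) ≤
        BruhatRicci.ric (BruhatRicci.H (BruhatRicci.gensA n))) ∧
    (∀ n : ℕ, 2 ≤ n → n ≤ 5 →
      (((4 * (-2 * (n : ℤ) + 1) : ℤ) : ℝ) : EReal) ≤
        BruhatRicci.ric (BruhatRicci.H (BruhatRicci.gensB n))) ∧
    (∀ n : ℕ, 5 ≤ n →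
      (((-2 * ⌊(n : ℝ) ^ 2 / 2⌋ - 2 * (n : ℤ) + 6 : ℤ) : ℝ) : EReal) ≤
        BruhatRicci.ric (BruhatRicci.H (BruhatRicci.gensB n))) ∧
    (∀ n : ℕ, 3 ≤ n →
      (((-2 * ⌊(n : ℝ) ^ 2 / 2⌋ - 2 * (n : ℤ) + 6 : ℤ) : ℝ) : EReal) ≤
        BruhatRicci.ric (BruhatRicci.H (BruhatRicci.gensD n))) := by
  refine ⟨fun n hn => ?_, fun n hn hn5 => ?_, fun n hn => ?_, fun n hn => ?_⟩
  · rcases hn.eq_or_lt with rfl | hn3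
    · have hfloor : ⌊((2 : ℕ) : ℝ) ^ 2 / 2⌋ = 2 := by norm_num
      have h := two_le_ric_of_degree_le_one (H (gensA 2)) (degree_gensA_le 2)
      rw [hfloor]
      norm_num
      exact_mod_cast h
    · refine le_ric_of_degree_le _ (degree_gensA_le n) ?_
      have h := natCast_sq_half_le_floor n
      have hc := two_mul_choose_two n
      -- After doubling, the squares cancel and `13 ≤ 5 * n` suffices.
      have h2 : (-⌊(n : ℝ) ^ 2 / 2⌋ - 2 * (n : ℤ) + 8 : ℤ) ≤ 2 - (n.choose 2 : ℤ) := by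
        omega
      exact_mod_cast h2
  · refine le_ric_of_degree_le _ degree_gensB_le ?_
    have h2 : (4 * (-2 * (n : ℤ) + 1) : ℤ) ≤ 2 - ((n ^ 2 : ℕ) : ℤ) := by
      interval_cases n <;> norm_num
    exact_mod_cast h2
  · exact le_ric_of_degree_le _ degree_gensB_le (bound_le_of_sq_degree (by omega))
  · exact le_ric_of_degree_le _ degree_gensD_le (bound_le_of_sq_degree hn)
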